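/- For a series $f=\sum f_{\alpha,\beta}x^\alpha y^\beta\in\mathbb{C}[[x,y]]$, let $Z(f)\hookrightarrow(\mathbb{C}^2,0)$ be the formal germ defined by $f$. The local tropicalization of $Z(f)$ is the topological closure in $\mathbb{R}^2$ of the union of the rays $\mathbb{R}_{\geq 0}\,(a,b)$ over all vectors $(a,b)\in\mathbb{Z}_{>0}^2$ of initial exponents of formal arcs contained in $Z(f)$ but not in the union of the coordinate axes, that is, over all $(a,b)$ for which there are series $x(t)=c_1t^{a}+\cdots$ and $y(t)=c_2t^{b}+\cdots$ in $\mathbb{C}[[t]]$, consisting of their initial terms and terms of higher order, with $c_1,c_2\in\mathbb{C}^*$ and $f(x(t),y(t))=0$. (If there is no such arc, the local tropicalization is empty.) Let $(p,q)\in\mathbb{Z}_{>0}^2$ and $f\in\mathbb{C}[[x,y]]\smallsetminus\{0\}$. Let $\mathrm{supp}\,f$ be the set of $(\alpha,\beta)\in\mathbb{Z}_{\geq 0}^2$ with $f_{\alpha,\beta}\neq 0$, and let $\delta_{(p,q)}(f)\subseteq\mathrm{supp}\,f$ be the (finite) set of those $(\alpha,\beta)\in\mathrm{supp}\,f$ at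 which $p\alpha+q\beta$ attains its minimum on $\mathrm{supp}\,f$. The $(p,q)$-initial form of $f$ is the polynomial $$\mathrm{in}_{(p,q)}f=\sum_{(\alpha,\beta)\in\delta_{(p,q)}(f)}f_{\alpha,\beta}\,x^\alpha y^\beta\in\mathbb{C}[x,y].$$ Then $(p,q)$ belongs to the local tropicalization of $Z(f)\hookrightarrow(\mathbb{C}^2,0)$ if and only if $\mathrm{in}_{(p,q)}f$ is not a monomial, where a monomial means a single nonzero term $c\,x^\alpha y^\beta$ with $c\in\mathbb{C}^*$. -/

import Mathlib

namespace LocalTrop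

open scoped PowerSeries

/-- The ring `ℂ[[x₁, …, xₙ]]` of formal power series, the local ring of `(ℂⁿ, 0)`. For `n = 2`
the variables are `x = X 0` and `y = X 1`. -/
abbrev FormalRing (n : ℕ) : Type := MvPowerSeries (Fin n) ℂ

/-- A formal arc `t ↦ (γ₁(t), …, γₙ(t))` of the germ `(ℂⁿ, 0)`: the components are
formal power series in `t` without constant term. -/
structure FormalArc (n : ℕ) where
  coord : Fin n → ℂ⟦X⟧
  constantCoeff_coord : ∀ i, PowerSeries.constantCoeff (coord i) = 0

namespace FormalArc

variable {n : ℕ}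

/-- The components of an arc may be substituted into any power series. -/
theorem hasSubst (γ : FormalArc n) : MvPowerSeries.HasSubst γ.coord :=
  MvPowerSeries.hasSubst_of_constantCoeff_zero γ.constantCoeff_coord

/-- The series `f(γ₁(t), …, γₙ(t))`. -/
noncomputable def pullback (γ : FormalArc n) (f : FormalRing n) : ℂ⟦X⟧ :=
  MvPowerSeries.subst γ.coord f

/-- The arc is contained in the germ defined by the ideal `I`: every series of `I` vanishes
identically along it. -/
def ContainedIn (γ : FormalArc n) (I : Ideal (FormalRing n)) : Prop :=
  ∀ f ∈ I, γ.pullback f = 0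

/-- The arc is not contained in the union of the coordinate hyperplanes. As `ℂ[[t]]` is a domain,
this means that none of its components is identically zero. -/
def IsInterior (γ : FormalArc n) : Prop :=
  ∀ i, γ.coord i ≠ 0

/-- `w` is the vector of initial exponents of the arc, that is, `γᵢ(t) = cᵢ t ^ wᵢ + ⋯` with
`cᵢ ≠ 0` for every `i`. -/
def HasWeight (γ : FormalArc n) (w : Fin n → ℕ) : Prop :=
  ∀ i, (γ.coord i).order = (w i : ℕ∞)

end FormalArc

/-- The arcwise weight vectors of the germ defined by `I`: the vectors of initial exponents of
the arcs contained in the germ but not in the union of the coordinate hyperplanes. -/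
def arcWeights {n : ℕ} (I : Ideal (FormalRing n)) : Set (Fin n → ℕ) :=
  {w | ∃ γ : FormalArc n, γ.ContainedIn I ∧ γ.IsInterior ∧ γ.HasWeight w}

/-- The local tropicalization of the germ defined by `I`: the closure in `ℝⁿ` of the
union of the rays `ℝ≥0 w` generated by its arcwise weight vectors `w`. -/
def localTropicalization {n : ℕ} (I : Ideal (FormalRing n)) : Set (Fin n → ℝ) :=
  closure (⋃ w ∈ arcWeights I, {v | ∃ r : ℝ, 0 ≤ r ∧ v = r • fun i => (w i : ℝ)})

/-- The ideal defining the germ `Z(f)` in `(ℂⁿ, 0)`. -/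
noncomputable def zeroGerm {n : ℕ} (f : FormalRing n) : Ideal (FormalRing n) :=
  Ideal.span {f}

/-- The set of exponents of the monomials that appear in `f`. -/
def supp {n : ℕ} (f : FormalRing n) : Set (Fin n →₀ ℕ) :=
  {d | MvPowerSeries.coeff d f ≠ 0}

/-- The value at the exponent `d` of the linear form given by the weight vector `w`. -/
def height {n : ℕ} (w : Fin n → ℕ) (d : Fin n →₀ ℕ) : ℕ :=
  ∑ i, w i * d i

/-- The basis of the support of `f` relative to `w`: the set of exponents in the support at which
the linear form given by `w` attains its minimum on the support. -/
def basis {n : ℕ} (w : Fin n → ℕ) (f : FormalRing n) : Set (Fin n →₀ ℕ) :=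
  {d | d ∈ supp f ∧ ∀ e ∈ supp f, height w d ≤ height w e}

theorem basis_finite {n : ℕ} {w : Fin n → ℕ} (hw : ∀ i, 0 < w i) (f : FormalRing n) :
    (basis w f).Finite := by
  rcases (basis w f).eq_empty_or_nonempty with h | ⟨d₀, h₀⟩
  · rw [h]; exact Set.finite_empty
  · refine (Set.finite_Iic (Finsupp.equivFunOnFinite.symm fun _ : Fin n => height w d₀)).subset ?_
    intro d hd i
    have h1 : height w d ≤ height w d₀ := hd.2 d₀ h₀.1
    have h2 : w i * d i ≤ height w d :=
      Finset.single_le_sum (f := fun j => w j * d j) (fun _ _ => Nat.zero_le _)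
        (Finset.mem_univ i)
    have h3 : d i ≤ w i * d i := Nat.le_mul_of_pos_left _ (hw i)
    simpa using h3.trans (h2.trans h1)

/-- The `w`-initial form of `f`, for a weight vector `w` with positive entries: the polynomial
made of the terms of `f` whose exponents are in the basis of the support relative to `w`. -/
noncomputable def initialForm {n : ℕ} (w : Fin n → ℕ) (hw : ∀ i, 0 < w i) (f : FormalRing n) :
    MvPolynomial (Fin n) ℂ :=
  ∑ d ∈ (basis_finite hw f).toFinset, MvPolynomial.monomial d (MvPowerSeries.coeff d f)

/-- A polynomial that consists of a single nonzero term. -/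
def IsMonomial {n : ℕ} (P : MvPolynomial (Fin n) ℂ) : Prop :=
  ∃ (d : Fin n →₀ ℕ) (c : ℂ), c ≠ 0 ∧ P = MvPolynomial.monomial d c

end LocalTrop

open scoped PowerSeries Polynomial

namespace LocalTrop

/-! Suppose the initial form is a single term, with exponent `d`. Along an arc whose ray passes
close to `w`, the term of `f` at `d` has strictly smaller order in `t` than every other term, so `f`
cannot vanish there (`FormalArc.pullback_ne_zero`). How close the ray must be depends only on
`height w d`, hence is uniform over the possibly infinite support (`height_lt_of_near`); this
excludes `w` from the closure as well.

Conversely, if two exponents attain the minimum, the initial form at `x = 1` has a root `c ≠ 0`. In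
the chart `x = t ^ p`, `y = t ^ q (c + u)` the series `f` becomes a power of `t` times some `g` with
`g(0, 0) = 0` and `g(0, u) ≠ 0` (`exists_strict_transform`). Weierstrass preparation replaces `g` by
a monic polynomial in `u` over `ℂ⟦t⟧`, and Newton–Puiseux (`hasPuiseuxRoot`) gives a solution `t = s
^ N`, `u = v(s)` with `v(0) = 0`. Since `c ≠ 0`, the resulting arc has weight `N (p, q)`, which lies
on the ray of `(p, q)`.

Newton–Puiseux goes by induction on the degree: after a Tschirnhaus shift and a rescaling by a
Newton slope, the reduction modulo `t` has a root of multiplicity below the degree, and Weierstrass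
preparation at that root splits off a factor of smaller degree. -/

/-! ### Weierstrass preparation over `k⟦X⟧` -/

theorem mem_maximalIdeal_iff_constantCoeff_eq_zero {k : Type*} [Field k] (a : k⟦X⟧) :
    a ∈ IsLocalRing.maximalIdeal k⟦X⟧ ↔ PowerSeries.constantCoeff a = 0 := by
  rw [PowerSeries.maximalIdeal_eq_span_X, Ideal.mem_span_singleton, PowerSeries.X_dvd_iff]

/-- Weierstrass preparation needs a complete coefficient ring; separatedness alone gives the
uniqueness of Weierstrass division. -/
instance isAdicComplete_maximalIdeal {k : Type*} [Field k] :
    IsAdicComplete (IsLocalRing.maximalIdeal k⟦X⟧) k⟦X⟧ := by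
  rw [PowerSeries.maximalIdeal_eq_span_X]; infer_instance

/-- Weierstrass preparation for a power series over `k⟦X⟧` that is regular of order `m`. -/
theorem exists_weierstrass_factor {k : Type*} [Field k] (g : k⟦X⟧⟦X⟧) (m : ℕ)
    (h0 : ∀ i < m, PowerSeries.constantCoeff (PowerSeries.coeff i g) = 0)
    (hm : PowerSeries.constantCoeff (PowerSeries.coeff m g) ≠ 0) :
    ∃ (F : k⟦X⟧[X]) (U : k⟦X⟧⟦X⟧),
      F.IsDistinguishedAt (IsLocalRing.maximalIdeal k⟦X⟧) ∧ F.natDegree = m ∧ g = F * U := by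
  have hc (i : ℕ) : PowerSeries.coeff i (g.map (IsLocalRing.residue k⟦X⟧)) = 0 ↔
      PowerSeries.constantCoeff (PowerSeries.coeff i g) = 0 := by
    rw [PowerSeries.coeff_map, IsLocalRing.residue_eq_zero_iff,
      mem_maximalIdeal_iff_constantCoeff_eq_zero]
  have hord : (g.map (IsLocalRing.residue k⟦X⟧)).order = m :=
    PowerSeries.order_eq_nat.2 ⟨fun h => hm ((hc m).1 h), fun i hi => (hc i).2 (h0 i hi)⟩
  have hne : g.map (IsLocalRing.residue k⟦X⟧) ≠ 0 := by
    intro h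
    rw [h, PowerSeries.order_zero] at hord
    exact absurd hord (ENat.top_ne_natCast m)
  obtain ⟨F, U, H⟩ := PowerSeries.exists_isWeierstrassFactorization hne
  refine ⟨F, U, H.isDistinguishedAt, ?_, H.eq_mul⟩
  rw [H.natDegree_eq_toNat_order_map, hord, ENat.toNat_natCast]

/-- A distinguished polynomial that divides a polynomial as a power series divides it as a
polynomial. -/
theorem dvd_of_coe_eq_mul {A : Type*} [CommRing A] {I : Ideal A} [IsHausdorff I A]
    {F Q : A[X]} (hI : I ≠ ⊤) (hF : F.IsDistinguishedAt I) {U : A⟦X⟧} (h : (Q : A⟦X⟧) = F * U) :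
    F ∣ Q := by
  have : Nontrivial A := by
    by_contra hn
    rw [not_nontrivial_iff_subsingleton] at hn
    exact hI (Subsingleton.elim _ _)
  have hord : ((F : A⟦X⟧).map (Ideal.Quotient.mk I)).order.toNat = F.natDegree := by
    rw [← hF.coe_natDegree_eq_order_map F 1 (by rwa [PowerSeries.constantCoeff_one,
      ← Ideal.ne_top_iff_one]) (by simp), ENat.toNat_natCast]
  -- Both `Q = F * U + 0` and Euclidean division by the monic `F` are Weierstrass divisions of `Q`;
  -- uniqueness forces `Q %ₘ F = 0`.
  have key := (hF.isWeierstrassDivisorAt hI).eq_of_mul_add_eq_mul_add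
    (q := U) (q' := ((Q /ₘ F : A[X]) : A⟦X⟧)) (r := 0) (r' := Q %ₘ F)
    (by rw [Polynomial.degree_zero]; exact WithBot.bot_lt_coe _)
    (by
      rw [hord, ← Polynomial.degree_eq_natDegree hF.monic.ne_zero]
      exact Polynomial.degree_modByMonic_lt _ hF.monic)
    (by
      rw [Polynomial.coe_zero, add_zero, ← h, ← Polynomial.coe_mul, ← Polynomial.coe_add, add_comm,
        Polynomial.modByMonic_add_div])
  exact (Polynomial.modByMonic_eq_zero_iff_dvd hF.monic).1 key.2.symm

/-! ### The Newton–Puiseux theorem -/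

/-- The Tschirnhaus substitution removes the second highest coefficient. -/
theorem coeff_taylor_natDegree_sub_one {A : Type*} [CommRing A] [Nontrivial A] {P : A[X]}
    (hP : P.Monic) (hn : 0 < P.natDegree) (r : A) :
    (Polynomial.taylor r P).coeff (P.natDegree - 1) =
      P.coeff (P.natDegree - 1) + P.natDegree * r := by
  obtain ⟨n, hn'⟩ : ∃ n, P.natDegree = n + 1 := ⟨P.natDegree - 1, by omega⟩
  have hdeg : (Polynomial.hasseDeriv n P).natDegree < 2 := by
    have := Polynomial.natDegree_hasseDeriv_le P n
    omega
  have h1 : P.coeff (n + 1) = 1 := by rw [← hn']; exact hP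
  rw [Polynomial.taylor_coeff, hn', Nat.add_sub_cancel, Polynomial.eval_eq_sum_range' hdeg]
  simp [Finset.sum_range_succ, Polynomial.hasseDeriv_coeff, h1, add_comm 1 n]

/-- A monic polynomial of degree `n` over an algebraically closed field of characteristic zero, with
vanishing second highest coefficient and different from `X ^ n`, has a root whose multiplicity is
less than `n`. -/
theorem exists_root_multiplicity_lt {k : Type*} [Field k] [IsAlgClosed k] [CharZero k]
    {R : k[X]} (hR : R.Monic) (hn : 0 < R.natDegree) (h1 : R.coeff (R.natDegree - 1) = 0)
    (hne : R ≠ Polynomial.X ^ R.natDegree) :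
    ∃ c m, 0 < m ∧ m < R.natDegree ∧ (Polynomial.taylor c R).coeff m ≠ 0 ∧
      ∀ i < m, (Polynomial.taylor c R).coeff i = 0 := by
  obtain ⟨c, hc⟩ := IsAlgClosed.exists_root R
    (by rw [Polynomial.degree_eq_natDegree hR.ne_zero]; exact_mod_cast hn.ne')
  have hT0 : Polynomial.taylor c R ≠ 0 := by
    rw [Ne, Polynomial.taylor_eq_zero]; exact hR.ne_zero
  have hTm : (Polynomial.taylor c R).Monic := by
    rw [Polynomial.Monic, Polynomial.leadingCoeff, Polynomial.natDegree_taylor,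
      Polynomial.coeff_taylor_natDegree]
    exact hR
  -- The trailing degree of the Taylor shift is the multiplicity of `c`. If it were the full degree
  -- `n`, the shift would be `X ^ n`, so `n * c = 0`, hence `c = 0` and `R = X ^ n`.
  refine ⟨c, (Polynomial.taylor c R).natTrailingDegree, ?_, ?_, ?_, ?_⟩
  · rw [Nat.pos_iff_ne_zero, Ne, Polynomial.natTrailingDegree_eq_zero, not_or, not_not]
    refine ⟨hT0, ?_⟩
    rw [Polynomial.taylor_coeff_zero]; exact hc
  · rw [← Polynomial.natDegree_taylor R c]
    refine lt_of_le_of_ne (Polynomial.natTrailingDegree_le_natDegree _) fun heq => hne ?_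
    have hX : Polynomial.taylor c R = Polynomial.X ^ R.natDegree := by
      ext i
      rw [Polynomial.coeff_X_pow]
      rw [Polynomial.natDegree_taylor] at heq
      rcases lt_trichotomy i R.natDegree with hi | hi | hi
      · rw [if_neg hi.ne]
        exact Polynomial.coeff_eq_zero_of_lt_natTrailingDegree (heq ▸ hi)
      · rw [if_pos hi, hi, Polynomial.coeff_taylor_natDegree]; exact hR
      · rw [if_neg hi.ne']
        exact Polynomial.coeff_eq_zero_of_natDegree_lt (by rwa [Polynomial.natDegree_taylor])
    have hcoef := coeff_taylor_natDegree_sub_one hR hn c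
    rw [hX, h1, zero_add, Polynomial.coeff_X_pow, if_neg (by omega)] at hcoef
    have hc0 : c = 0 := by
      rcases mul_eq_zero.1 hcoef.symm with h | h
      · exact absurd (Nat.cast_eq_zero.1 h) hn.ne'
      · exact h
    rwa [hc0, Polynomial.taylor_zero] at hX
  · exact fun h => hT0 (Polynomial.trailingCoeff_eq_zero.1 h)
  · exact fun i hi => Polynomial.coeff_eq_zero_of_lt_natTrailingDegree hi

/-- `u(t)` is a root of `P(t ^ N, ·)` for some `N > 0`. -/
def HasPuiseuxRoot {k : Type*} [Field k] (P : k⟦X⟧[X]) : Prop :=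
  ∃ (N : ℕ) (hN : N ≠ 0) (u : k⟦X⟧),
    P.eval₂ (PowerSeries.expand N hN : k⟦X⟧ →ₐ[k] k⟦X⟧).toRingHom u = 0

theorem HasPuiseuxRoot.of_dvd {k : Type*} [Field k] {F P : k⟦X⟧[X]} (h : F ∣ P)
    (hF : HasPuiseuxRoot F) : HasPuiseuxRoot P := by
  obtain ⟨N, hN, u, hu⟩ := hF
  exact ⟨N, hN, u, Polynomial.eval₂_eq_zero_of_dvd_of_eval₂_eq_zero _ _ h hu⟩

/-- The shift `r` is a series in `t`, so after `t = s ^ N` the root moves by `r(s ^ N)`. -/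
theorem HasPuiseuxRoot.of_taylor {k : Type*} [Field k] {P : k⟦X⟧[X]} {r : k⟦X⟧}
    (hP : HasPuiseuxRoot (Polynomial.taylor r P)) : HasPuiseuxRoot P := by
  obtain ⟨N, hN, u, hu⟩ := hP
  refine ⟨N, hN, u + PowerSeries.expand N hN r, ?_⟩
  rw [Polynomial.taylor_apply, Polynomial.eval₂_comp] at hu
  simpa using hu

/-- Substitution `t = s ^ b`, `Z = s ^ e V`. -/
theorem HasPuiseuxRoot.of_scale {k : Type*} [Field k] {P Q : k⟦X⟧[X]} {b e n : ℕ} (hb : b ≠ 0)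
    (hP : P.natDegree ≤ n) (hQ : Q.natDegree ≤ n)
    (h : ∀ i ≤ n, PowerSeries.expand b hb (P.coeff i) = PowerSeries.X ^ (e * (n - i)) * Q.coeff i)
    (hroot : HasPuiseuxRoot Q) : HasPuiseuxRoot P := by
  obtain ⟨N, hN, v, hv⟩ := hroot
  refine ⟨N * b, mul_ne_zero hN hb, PowerSeries.X ^ (N * e) * v, ?_⟩
  rw [Polynomial.eval₂_eq_sum_range' _ (Nat.lt_succ_of_le hQ)] at hv
  rw [Polynomial.eval₂_eq_sum_range' _ (Nat.lt_succ_of_le hP)]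
  have : (0 : k⟦X⟧) = PowerSeries.X ^ (N * e * n) * 0 := by simp
  rw [this, ← hv, Finset.mul_sum]
  refine Finset.sum_congr rfl fun i hi => ?_
  have hi : i ≤ n := Nat.lt_succ_iff.1 (Finset.mem_range.1 hi)
  obtain ⟨j, rfl⟩ := Nat.exists_eq_add_of_le hi
  have hx := h i hi
  rw [Nat.add_sub_cancel_left] at hx
  change PowerSeries.expand (N * b) _ _ * _ = _ * (PowerSeries.expand N hN _ * _)
  rw [PowerSeries.expand_mul N hN b hb, hx, map_mul, map_pow, PowerSeries.expand_X]
  ring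

/-- A distinguished factor of lower degree splits off at a root of the reduction of `Q`. -/
theorem exists_distinguished_dvd_taylor {k : Type*} [Field k] (Q : k⟦X⟧[X]) (c : k) (m : ℕ)
    (h0 : ∀ i < m, (Polynomial.taylor c (Q.map PowerSeries.constantCoeff)).coeff i = 0)
    (hm : (Polynomial.taylor c (Q.map PowerSeries.constantCoeff)).coeff m ≠ 0) :
    ∃ F : k⟦X⟧[X], F.Monic ∧ F.natDegree = m ∧
      F ∣ Polynomial.taylor (PowerSeries.C c) Q := by
  have hc (i : ℕ) : PowerSeries.constantCoeff (PowerSeries.coeff i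
      ((Polynomial.taylor (PowerSeries.C c) Q : k⟦X⟧[X]) : k⟦X⟧⟦X⟧)) =
      (Polynomial.taylor c (Q.map PowerSeries.constantCoeff)).coeff i := by
    have := Polynomial.map_taylor Q (PowerSeries.C c) (PowerSeries.constantCoeff (R := k))
    rw [PowerSeries.constantCoeff_C] at this
    rw [← this, Polynomial.coeff_map, Polynomial.coeff_coe]
  obtain ⟨F, U, hF, hd, h⟩ := exists_weierstrass_factor
    ((Polynomial.taylor (PowerSeries.C c) Q : k⟦X⟧[X]) : k⟦X⟧⟦X⟧) m
    (fun i hi => by rw [hc]; exact h0 i hi) (by rw [hc]; exact hm)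
  exact ⟨F, hF.monic, hd, dvd_of_coe_eq_mul (Ideal.IsPrime.ne_top inferInstance) hF h⟩

/-- Rescaling a monic polynomial by the smallest slope of its Newton polygon. -/
theorem exists_scaling {k : Type*} [Field k] {P : k⟦X⟧[X]} (hP : P.Monic)
    (hne : ∃ i < P.natDegree, P.coeff i ≠ 0) :
    ∃ (b : ℕ) (hb : b ≠ 0) (e : ℕ) (Q : k⟦X⟧[X]), Q.Monic ∧ Q.natDegree = P.natDegree ∧
      (∀ i ≤ P.natDegree, PowerSeries.expand b hb (P.coeff i) =
        PowerSeries.X ^ (e * (P.natDegree - i)) * Q.coeff i) ∧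
      ∃ i < P.natDegree, PowerSeries.constantCoeff (Q.coeff i) ≠ 0 := by
  classical
  set n := P.natDegree with hn
  let S := (Finset.range n).filter fun i => P.coeff i ≠ 0
  have hS : S.Nonempty := by
    obtain ⟨i, hi, h⟩ := hne
    exact ⟨i, by simp [S, hi, h]⟩
  -- The smallest slope `ord a_i / (n - i)` is `e / b` with `b = n - j` and `e = ord a_j`; the
  -- substitution `t = s ^ b` clears its denominator.
  obtain ⟨j, hjS, hj⟩ := S.exists_min_image
    (fun i => ((P.coeff i).order.toNat : ℚ) / ((n - i : ℕ) : ℚ)) hS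
  obtain ⟨hjn, hj0⟩ : j < n ∧ P.coeff j ≠ 0 := by simpa [S] using hjS
  have hb : n - j ≠ 0 := by omega
  set e := (P.coeff j).order.toNat with he
  have hord (i : ℕ) (hi : i < n) (h0 : P.coeff i ≠ 0) :
      e * (n - i) ≤ (n - j) * (P.coeff i).order.toNat := by
    have := hj i (by simp [S, hi, h0])
    rw [div_le_div_iff₀ (by exact_mod_cast (by omega : 0 < n - j))
      (by exact_mod_cast (by omega : 0 < n - i))] at this
    rw [mul_comm (n - j)]
    exact_mod_cast this
  have hdvd (i : ℕ) (hi : i ≤ n) :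
      (PowerSeries.X : k⟦X⟧) ^ (e * (n - i)) ∣ PowerSeries.expand (n - j) hb (P.coeff i) := by
    rcases hi.eq_or_lt with rfl | hi
    · simp
    by_cases h0 : P.coeff i = 0
    · simp [h0]
    · refine (pow_dvd_pow _ (hord i hi h0)).trans ?_
      rw [pow_mul, ← PowerSeries.expand_X (n - j) hb, ← map_pow]
      exact map_dvd _ PowerSeries.X_pow_order_dvd
  choose! q hq using hdvd
  have hqn : q n = 1 := by
    have := hq n le_rfl
    rw [Nat.sub_self, mul_zero, pow_zero, one_mul] at this
    rw [← this, show P.coeff n = 1 from hP.coeff_natDegree, map_one]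
  let Q : k⟦X⟧[X] := ∑ i ∈ Finset.range (n + 1), Polynomial.C (q i) * Polynomial.X ^ i
  have hQc (i : ℕ) (hi : i ≤ n) : Q.coeff i = q i := by
    simp only [Q, Polynomial.finsetSum_coeff, Polynomial.coeff_C_mul_X_pow]
    rw [Finset.sum_ite_eq, if_pos (by simp; omega)]
  have hQd : Q.natDegree ≤ n := Polynomial.natDegree_sum_le_of_forall_le _ _ fun i hi =>
    (Polynomial.natDegree_C_mul_X_pow_le _ _).trans (by simp at hi; omega)
  have hQ1 : Q.coeff n = 1 := by rw [hQc n le_rfl, hqn]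
  have hQn : Q.natDegree = n := hQd.antisymm
    (Polynomial.le_natDegree_of_ne_zero (by rw [hQ1]; exact one_ne_zero))
  refine ⟨n - j, hb, e, Q, ?_, hQn, ?_, j, hjn, ?_⟩
  · rw [Polynomial.Monic, Polynomial.leadingCoeff, hQn, hQ1]
  · intro i hi
    rw [hq i hi, hQc i hi]
  · rw [hQc j hjn.le]
    -- The slope is attained at `j`: the expanded coefficient has order exactly `e * (n - j)`, so
    -- the quotient `q j` is a unit.
    have h := hq j hjn.le
    intro h0
    have hc := congrArg (PowerSeries.coeff ((n - j) * e)) h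
    rw [PowerSeries.coeff_expand_mul, mul_comm (n - j) e] at hc
    have := PowerSeries.coeff_X_pow_mul (q j) (e * (n - j)) 0
    rw [zero_add, PowerSeries.coeff_zero_eq_constantCoeff, h0] at this
    rw [this] at hc
    exact PowerSeries.coeff_order hj0 hc

/-- **Newton–Puiseux theorem** for monic polynomials over `k⟦t⟧`. -/
theorem hasPuiseuxRoot {k : Type*} [Field k] [IsAlgClosed k] [CharZero k] (n : ℕ) :
    ∀ P : k⟦X⟧[X], P.Monic → P.natDegree = n → 0 < n → HasPuiseuxRoot P := by
  induction n using Nat.strong_induction_on with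
  | _ n ih =>
  suffices H : ∀ P : k⟦X⟧[X], P.Monic → P.natDegree = n → 0 < n → P.coeff (n - 1) = 0 →
      HasPuiseuxRoot P by
    intro P hP hd hn
    let r : k⟦X⟧ := PowerSeries.C (-(n : k)⁻¹) * P.coeff (n - 1)
    refine HasPuiseuxRoot.of_taylor (r := r) (H _ ?_ (by rw [Polynomial.natDegree_taylor, hd]) hn ?_)
    · rw [Polynomial.Monic, Polynomial.leadingCoeff, Polynomial.natDegree_taylor,
        Polynomial.coeff_taylor_natDegree]
      exact hP
    · have := coeff_taylor_natDegree_sub_one hP (hd ▸ hn) r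
      rw [hd] at this
      rw [this]
      have hn0 : (n : k) ≠ 0 := Nat.cast_ne_zero.2 hn.ne'
      have : (n : k⟦X⟧) = PowerSeries.C (n : k) := (map_natCast _ n).symm
      rw [this, ← mul_assoc, ← map_mul, mul_neg, mul_inv_cancel₀ hn0, map_neg, map_one]
      ring
  intro P hP hd hn h1
  by_cases hne : ∃ i < P.natDegree, P.coeff i ≠ 0
  · obtain ⟨b, hb, e, Q, hQ, hQd, hPQ, j, hj, hqj⟩ := exists_scaling hP hne
    refine HasPuiseuxRoot.of_scale hb le_rfl hQd.le hPQ ?_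
    have hRd : (Q.map PowerSeries.constantCoeff).natDegree = n := by
      rw [hQ.natDegree_map, hQd, hd]
    obtain ⟨c, m, hm0, hmn, hm, hlt⟩ := exists_root_multiplicity_lt
      (hQ.map (PowerSeries.constantCoeff (R := k))) (by rw [hRd]; exact hn)
      (by
        have h := hPQ (n - 1) (by omega)
        rw [h1, map_zero, eq_comm, mul_eq_zero] at h
        rw [hRd, Polynomial.coeff_map, h.resolve_left (pow_ne_zero _ PowerSeries.X_ne_zero),
          map_zero])
      -- The unit coefficient at `j < n` survives reduction, so the reduction is not `X ^ n`.
      (by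
        intro h
        have := congrArg (fun R => Polynomial.coeff R j) h
        simp only [Polynomial.coeff_map, Polynomial.coeff_X_pow, hRd] at this
        rw [if_neg (by omega)] at this
        exact hqj this)
    obtain ⟨F, hF, hFd, hdvd⟩ := exists_distinguished_dvd_taylor Q c m hlt hm
    exact ((ih m (hRd ▸ hmn) F hF hFd hm0).of_dvd hdvd).of_taylor
  -- All lower coefficients vanish, so `P = X ^ n` and `0` is a root.
  · push Not at hne
    refine ⟨1, one_ne_zero, 0, ?_⟩
    rw [Polynomial.eval₂_at_zero, hne 0 (by omega), map_zero]

/-! ### Evaluation of series in `(t, u)` along arcs -/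

/-- A one-variable series in the inner variable, seen as a series in the two variables indexed by
`Option Unit`. -/
theorem optionEquivLeft_rename_some {R : Type*} [CommSemiring R] (g : R⟦X⟧) :
    MvPowerSeries.optionEquivLeft Unit R
      (MvPowerSeries.rename (Function.Embedding.some : Unit ↪ Option Unit) g) =
      PowerSeries.C (R := R⟦X⟧) g := by
  ext n i
  rw [PowerSeries.coeff_C]
  change MvPowerSeries.coeff (Finsupp.single () i) _ = _
  rw [MvPowerSeries.coeff_coeff_optionEquivLeft]
  split_ifs with hn
  · subst hn
    have : (Finsupp.single () i).optionElim 0 =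
        Finsupp.embDomain (Function.Embedding.some : Unit ↪ Option Unit) (Finsupp.single () i) := by
      ext a
      cases a with
      | none =>
        rw [Finsupp.optionElim_apply_none, Finsupp.embDomain_of_notMem_range]
        simp
      | some a =>
        rw [Finsupp.optionElim_apply_some]
        exact (Finsupp.embDomain_apply_self Function.Embedding.some _ a).symm
    rw [this, MvPowerSeries.coeff_embDomain_rename]
    rfl
  · rw [map_zero]
    apply MvPowerSeries.coeff_rename_eq_zero
    rintro ⟨y, hy⟩
    apply hn
    have := congrArg (fun z => z none) hy
    simp only [Finsupp.optionElim_apply_none] at this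
    rw [← this, Finsupp.mapDomain_of_notMem_range]
    simp

/-- The substitution `t = s ^ N`, `u = v(s)` on two-variable series. -/
theorem hasSubst_arc {k : Type*} [Field k] {N : ℕ} (hN : N ≠ 0) {v : k⟦X⟧}
    (hv : PowerSeries.constantCoeff v = 0) :
    MvPowerSeries.HasSubst
      (fun o : Option Unit => (o.elim v fun _ => PowerSeries.X ^ N : k⟦X⟧)) := by
  refine MvPowerSeries.hasSubst_of_constantCoeff_zero fun o => ?_
  cases o with
  | none => exact hv
  | some _ =>
    change PowerSeries.constantCoeff ((PowerSeries.X : k⟦X⟧) ^ N) = 0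
    simp [hN]

/-- Evaluation of a series in `k⟦t⟧⟦u⟧` at `t = s ^ N`, `u = v(s)`. -/
noncomputable def evalArc {k : Type*} [Field k] {N : ℕ} (hN : N ≠ 0) {v : k⟦X⟧}
    (hv : PowerSeries.constantCoeff v = 0) : k⟦X⟧⟦X⟧ →+* k⟦X⟧ :=
  (MvPowerSeries.substAlgHom (R := k) (hasSubst_arc hN hv)).toRingHom.comp
    (MvPowerSeries.optionEquivLeft Unit k).symm.toAlgHom.toRingHom

theorem evalArc_apply {k : Type*} [Field k] {N : ℕ} (hN : N ≠ 0) {v : k⟦X⟧}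
    (hv : PowerSeries.constantCoeff v = 0) (g : MvPowerSeries (Option Unit) k) :
    evalArc hN hv (MvPowerSeries.optionEquivLeft Unit k g) =
      MvPowerSeries.subst (fun o : Option Unit => (o.elim v fun _ => PowerSeries.X ^ N : k⟦X⟧))
        g := by
  change MvPowerSeries.substAlgHom (R := k) (hasSubst_arc hN hv)
    ((MvPowerSeries.optionEquivLeft Unit k).symm (MvPowerSeries.optionEquivLeft Unit k g)) = _
  rw [AlgEquiv.symm_apply_apply, MvPowerSeries.substAlgHom_apply]

theorem evalArc_X {k : Type*} [Field k] {N : ℕ} (hN : N ≠ 0) {v : k⟦X⟧}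
    (hv : PowerSeries.constantCoeff v = 0) : evalArc hN hv PowerSeries.X = v := by
  have h := evalArc_apply hN hv (MvPowerSeries.X none)
  rw [MvPowerSeries.optionEquivLeft_X_none, MvPowerSeries.subst_X (hasSubst_arc hN hv)] at h
  exact h

theorem evalArc_C {k : Type*} [Field k] {N : ℕ} (hN : N ≠ 0) {v : k⟦X⟧}
    (hv : PowerSeries.constantCoeff v = 0) (g : k⟦X⟧) :
    evalArc hN hv (PowerSeries.C g) = PowerSeries.expand N hN g := by
  have h := evalArc_apply hN hv
    (MvPowerSeries.rename (Function.Embedding.some : Unit ↪ Option Unit) g)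
  rw [optionEquivLeft_rename_some, MvPowerSeries.rename_eq_subst,
    MvPowerSeries.subst_comp_subst_apply (MvPowerSeries.HasSubst.X_comp _)
      (hasSubst_arc hN hv)] at h
  rw [h, PowerSeries.expand_apply, PowerSeries.subst]
  congr 1
  ext1 s
  exact MvPowerSeries.subst_X (hasSubst_arc hN hv) _

/-- Through this identity a Puiseux root of the Weierstrass polynomial becomes an arc in the germ.
-/
theorem evalArc_coe {k : Type*} [Field k] {N : ℕ} (hN : N ≠ 0) {v : k⟦X⟧}
    (hv : PowerSeries.constantCoeff v = 0) (F : k⟦X⟧[X]) :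
    evalArc hN hv (F : k⟦X⟧⟦X⟧) =
      F.eval₂ (PowerSeries.expand N hN : k⟦X⟧ →ₐ[k] k⟦X⟧).toRingHom v := by
  induction F using Polynomial.induction_on' with
  | add p q hp hq => rw [Polynomial.coe_add, map_add, hp, hq, Polynomial.eval₂_add]
  | monomial n a =>
    rw [Polynomial.coe_monomial, PowerSeries.monomial_eq_C_mul_X_pow, map_mul, map_pow, evalArc_C,
      evalArc_X, Polynomial.eval₂_monomial]
    rfl

/-- A plane germ in the coordinates `(t, u)` that contains the origin, but not the line `t = 0`,
contains an arc `t = s ^ N`, `u = v(s)`. -/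
theorem exists_evalArc_eq_zero {k : Type*} [Field k] [IsAlgClosed k] [CharZero k]
    (g : k⟦X⟧⟦X⟧) (m : ℕ) (hm0 : 0 < m)
    (h0 : ∀ i < m, PowerSeries.constantCoeff (PowerSeries.coeff i g) = 0)
    (hm : PowerSeries.constantCoeff (PowerSeries.coeff m g) ≠ 0) :
    ∃ (N : ℕ) (hN : N ≠ 0) (v : k⟦X⟧) (hv : PowerSeries.constantCoeff v = 0),
      evalArc hN hv g = 0 := by
  obtain ⟨F, U, hF, hd, rfl⟩ := exists_weierstrass_factor g m h0 hm
  obtain ⟨N, hN, v, hv⟩ := hasPuiseuxRoot m F hF.monic hd hm0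
  -- Modulo `s` the distinguished polynomial is `X ^ m`, so `v(0) ^ m = 0`; the arc therefore passes
  -- through the origin.
  have hv0 : PowerSeries.constantCoeff v = 0 := by
    have h := congrArg PowerSeries.constantCoeff hv
    have hlow (i : ℕ) (hi : i < m) : PowerSeries.constantCoeff (F.coeff i) = 0 :=
      (mem_maximalIdeal_iff_constantCoeff_eq_zero _).1 (hF.mem (hd ▸ hi))
    have htop : F.coeff m = 1 := by rw [← hd]; exact hF.monic
    rw [Polynomial.eval₂_eq_sum_range, hd, map_sum, Finset.sum_range_succ,
      Finset.sum_eq_zero, htop, map_one, one_mul, zero_add, map_pow, map_zero] at h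
    · exact pow_eq_zero_iff hm0.ne' |>.1 h
    · intro i hi
      rw [map_mul]
      change PowerSeries.constantCoeff (PowerSeries.expand N hN _) * _ = 0
      rw [PowerSeries.constantCoeff_expand, hlow i (Finset.mem_range.1 hi), zero_mul]
  exact ⟨N, hN, v, hv0, by rw [map_mul, evalArc_coe, hv, zero_mul]⟩

/-! ### Initial forms, and necessity of the condition -/

theorem supp_nonempty {n : ℕ} {f : FormalRing n} (hf : f ≠ 0) : (supp f).Nonempty := by
  by_contra h
  rw [Set.not_nonempty_iff_eq_empty] at h
  refine hf (MvPowerSeries.ext fun d => ?_)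
  by_contra hd
  have : d ∈ supp f := hd
  rw [h] at this
  exact this

theorem basis_nonempty {n : ℕ} (w : Fin n → ℕ) {f : FormalRing n} (hf : f ≠ 0) :
    (basis w f).Nonempty := by
  obtain ⟨d, hd, hmin⟩ := exists_minimalFor_of_wellFoundedLT (· ∈ supp f) (height w)
    (supp_nonempty hf)
  exact ⟨d, hd, fun e he => (le_total _ _).elim id (hmin he)⟩

/-- Distinct exponents with nonzero coefficients cannot cancel, so the support of the initial form
is exactly the basis. -/
theorem isMonomial_initialForm_iff {n : ℕ} {w : Fin n → ℕ} (hw : ∀ i, 0 < w i) {f : FormalRing n} :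
    IsMonomial (initialForm w hw f) ↔ ∃ d, basis w f = {d} := by
  classical
  have hcoeff (e : Fin n →₀ ℕ) : (initialForm w hw f).coeff e ≠ 0 ↔ e ∈ basis w f := by
    rw [initialForm, MvPolynomial.coeff_sum]
    simp only [MvPolynomial.coeff_monomial]
    rw [Finset.sum_ite_eq', ite_ne_right_iff, Set.Finite.mem_toFinset]
    exact ⟨fun h => h.1, fun h => ⟨h, h.1⟩⟩
  constructor
  · rintro ⟨d, c, hc, h⟩
    refine ⟨d, Set.ext fun e => ?_⟩
    rw [← hcoeff, h, MvPolynomial.coeff_monomial, Set.mem_singleton_iff]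
    by_cases hde : d = e <;> simp [hde, hc, eq_comm]
  · rintro ⟨d, h⟩
    have hd : d ∈ basis w f := by rw [h]; rfl
    refine ⟨d, MvPowerSeries.coeff d f, hd.1, ?_⟩
    rw [initialForm]
    have : (basis_finite hw f).toFinset = {d} := by ext; simp [h]
    rw [this, Finset.sum_singleton]

/-- The order of a monomial along an arc. -/
theorem FormalArc.HasWeight.order_prod {n : ℕ} {γ : FormalArc n} {w : Fin n → ℕ}
    (hγ : γ.HasWeight w) (d : Fin n →₀ ℕ) :
    (d.prod fun s e => γ.coord s ^ e).order = (height w d : ℕ∞) := by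
  rw [Finsupp.prod_fintype _ _ (fun _ => pow_zero _), PowerSeries.order_prod, height,
    Nat.cast_sum]
  refine Finset.sum_congr rfl fun i _ => ?_
  rw [PowerSeries.order_pow, hγ i, nsmul_eq_mul, Nat.cast_mul, mul_comm]

/-- A series whose initial form with respect to the weight of an arc is a monomial does not vanish
along the arc. -/
theorem FormalArc.pullback_ne_zero {n : ℕ} {γ : FormalArc n} {w : Fin n → ℕ}
    (hγ : γ.HasWeight w) {f : FormalRing n} {d : Fin n →₀ ℕ} (hd : d ∈ supp f)
    (hlt : ∀ e ∈ supp f, e ≠ d → height w d < height w e) : γ.pullback f ≠ 0 := by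
  intro h0
  -- In the coefficient of `t ^ height w d` only the term of `f` at `d` contributes, and its
  -- contribution is nonzero.
  have h := MvPowerSeries.coeff_subst γ.hasSubst f (Finsupp.single () (height w d))
  rw [show MvPowerSeries.subst γ.coord f = 0 from h0, map_zero, finsum_eq_single _ d] at h
  · rcases smul_eq_zero.1 h.symm with h | h
    · exact hd h
    · change PowerSeries.coeff (height w d) (d.prod fun s e => γ.coord s ^ e) = 0 at h
      exact (PowerSeries.order_eq_nat.1 (hγ.order_prod d)).1 h
  · intro e he
    by_cases hes : e ∈ supp f
    · have : PowerSeries.coeff (height w d) (e.prod fun s e => γ.coord s ^ e) = 0 := by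
        apply PowerSeries.coeff_of_lt_order
        rw [hγ.order_prod e]
        exact_mod_cast hlt e hes he
      exact (congrArg _ this).trans (smul_zero _)
    · rw [show MvPowerSeries.coeff e f = 0 from not_not.1 hes, zero_smul]

/-- A strict inequality of heights with respect to `w` persists for the weight vectors whose rays
come close to `w`, with a bound that depends on the smaller height only. -/
theorem height_lt_of_near {n : ℕ} {w w' : Fin n → ℕ} (hw : ∀ i, 0 < w i) {d e : Fin n →₀ ℕ}
    (hde : height w d < height w e) {r ε : ℝ} (hr : 0 ≤ r)
    (hε : ε * (2 * height w d + 1) < 1) (hε0 : 0 < ε)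
    (h : ∀ i, |(w i : ℝ) - r * w' i| < ε) : height w' d < height w' e := by
  -- As `w i ≥ 1`, the absolute error `ε` is at most the relative error `ε * w i`, which passes to
  -- heights.
  have hw1 (i : Fin n) : (1 : ℝ) ≤ w i := by exact_mod_cast hw i
  have hd : r * height w' d ≤ (1 + ε) * height w d := by
    rw [height, height]
    push_cast
    rw [Finset.mul_sum, Finset.mul_sum]
    refine Finset.sum_le_sum fun i _ => ?_
    rw [← mul_assoc, ← mul_assoc]
    refine mul_le_mul_of_nonneg_right ?_ (Nat.cast_nonneg _)
    have := abs_lt.1 (h i)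
    nlinarith [hw1 i]
  have he : (1 - ε) * height w e ≤ r * height w' e := by
    rw [height, height]
    push_cast
    rw [Finset.mul_sum, Finset.mul_sum]
    refine Finset.sum_le_sum fun i _ => ?_
    rw [← mul_assoc, ← mul_assoc]
    refine mul_le_mul_of_nonneg_right ?_ (Nat.cast_nonneg _)
    have := abs_lt.1 (h i)
    nlinarith [hw1 i]
  have h1 : (height w d : ℝ) + 1 ≤ height w e := by exact_mod_cast hde
  have hD : (0 : ℝ) ≤ height w d := Nat.cast_nonneg _
  have hε1 : ε < 1 := by nlinarith
  -- With `D = height w d`, `(1 - ε)(D + 1) > (1 + ε) D` is equivalent to `ε (2 D + 1) < 1`.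
  have key : r * height w' d < r * height w' e := by
    have := mul_le_mul_of_nonneg_left h1 (sub_nonneg.2 hε1.le)
    nlinarith
  exact_mod_cast lt_of_mul_lt_mul_left key hr

theorem not_isMonomial_of_mem {n : ℕ} {w : Fin n → ℕ} (hw : ∀ i, 0 < w i) {f : FormalRing n}
    (h : (fun i => (w i : ℝ)) ∈ localTropicalization (zeroGerm f)) :
    ¬ IsMonomial (initialForm w hw f) := by
  rw [isMonomial_initialForm_iff]
  rintro ⟨d, hd⟩
  have hdb : d ∈ basis w f := by rw [hd]; rfl
  have hlt (e) (he : e ∈ supp f) (hed : e ≠ d) : height w d < height w e := by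
    refine lt_of_le_of_ne (hdb.2 e he) fun heq => hed ?_
    have : e ∈ basis w f := ⟨he, fun e' he' => heq ▸ hdb.2 e' he'⟩
    rw [hd] at this
    exact this
  have hpos : (0 : ℝ) < 2 * height w d + 1 := by positivity
  set ε : ℝ := (2 * (2 * height w d + 1))⁻¹ with hε
  have hε0 : 0 < ε := by positivity
  have hε1 : ε * (2 * height w d + 1) < 1 := by
    rw [hε, mul_inv, mul_assoc, inv_mul_cancel₀ hpos.ne']
    norm_num
  obtain ⟨v, hv, hdist⟩ := Metric.mem_closure_iff.1 h ε hε0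
  simp only [Set.mem_iUnion] at hv
  obtain ⟨w', ⟨γ, hγ, -, hγw⟩, r, hr, rfl⟩ := hv
  refine FormalArc.pullback_ne_zero hγw hdb.1 (fun e he hed => ?_)
    (hγ f (Ideal.mem_span_singleton_self f))
  refine height_lt_of_near hw (hlt e he hed) hr hε1 hε0 fun i => ?_
  have := (dist_pi_lt_iff hε0).1 hdist i
  rwa [Real.dist_eq] at this

/-! ### The chart at a root of the initial form, and sufficiency -/

/-- A polynomial with two terms has a nonzero root. -/
theorem exists_root_ne_zero {k : Type*} [Field k] [IsAlgClosed k] {G : k[X]} {a b : ℕ}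
    (hab : a ≠ b) (ha : G.coeff a ≠ 0) (hb : G.coeff b ≠ 0) : ∃ c, c ≠ 0 ∧ G.IsRoot c := by
  have hG : G ≠ 0 := by rintro rfl; simp at ha
  -- Strip off the largest power of `X`: the cofactor `q` has `q(0) ≠ 0`, and it is not constant
  -- since `G` has two terms.
  obtain ⟨q, hq, hndvd⟩ := Polynomial.exists_eq_pow_rootMultiplicity_mul_and_not_dvd G hG 0
  rw [Polynomial.C_0, sub_zero] at hq hndvd
  have hq0 : q.eval 0 ≠ 0 := by
    rwa [Polynomial.X_dvd_iff, Polynomial.coeff_zero_eq_eval_zero] at hndvd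
  have hdeg : q.degree ≠ 0 := by
    intro h
    rw [Polynomial.eq_C_of_degree_eq_zero h, mul_comm] at hq
    rw [hq, Polynomial.coeff_C_mul_X_pow] at ha hb
    have h1 := (ite_ne_right_iff.1 ha).1
    have h2 := (ite_ne_right_iff.1 hb).1
    exact hab (h1.trans h2.symm)
  obtain ⟨c, hc⟩ := IsAlgClosed.exists_root q hdeg
  refine ⟨c, ?_, ?_⟩
  · rintro rfl
    exact hq0 hc
  · rw [hq, Polynomial.IsRoot, Polynomial.eval_mul, hc.eq_zero, mul_zero]

/-- The coordinate change `x = t ^ p`, `y = t ^ q (c + u)`, where `(p, q) = w`. -/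
noncomputable def chart (w : Fin 2 → ℕ) (c : ℂ) : Fin 2 → MvPowerSeries (Option Unit) ℂ :=
  ![MvPowerSeries.X (some ()) ^ w 0,
    MvPowerSeries.X (some ()) ^ w 1 * (MvPowerSeries.C c + MvPowerSeries.X none)]

theorem hasSubst_chart {w : Fin 2 → ℕ} (hw : ∀ i, 0 < w i) (c : ℂ) :
    MvPowerSeries.HasSubst (chart w c) := by
  refine MvPowerSeries.hasSubst_of_constantCoeff_zero fun i => ?_
  fin_cases i
  · simp [chart, (hw 0).ne']
  · simp [chart, (hw 1).ne']

theorem optionEquivLeft_chart_prod (w : Fin 2 → ℕ) (c : ℂ) (d : Fin 2 →₀ ℕ) :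
    MvPowerSeries.optionEquivLeft Unit ℂ (d.prod fun s e => chart w c s ^ e) =
      PowerSeries.C (R := ℂ⟦X⟧) (PowerSeries.X ^ height w d) *
        (((Polynomial.X + Polynomial.C c) ^ d 1 : ℂ[X]).map PowerSeries.C : ℂ⟦X⟧[X]) := by
  have hX : MvPowerSeries.optionEquivLeft Unit ℂ (MvPowerSeries.X (some ())) =
      PowerSeries.C (R := ℂ⟦X⟧) PowerSeries.X := MvPowerSeries.optionEquivLeft_X_some ()
  have hC : MvPowerSeries.optionEquivLeft Unit ℂ (MvPowerSeries.C c) =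
      PowerSeries.C (R := ℂ⟦X⟧) (PowerSeries.C c) := MvPowerSeries.optionEquivLeft_C c
  have hU : MvPowerSeries.optionEquivLeft Unit ℂ (MvPowerSeries.X none) =
      (PowerSeries.X : ℂ⟦X⟧⟦X⟧) := MvPowerSeries.optionEquivLeft_X_none
  rw [Finsupp.prod_fintype _ _ (fun _ => pow_zero _), Fin.prod_univ_two, height, Fin.sum_univ_two]
  have h0 : chart w c 0 = MvPowerSeries.X (some ()) ^ w 0 := rfl
  have h1 : chart w c 1 = MvPowerSeries.X (some ()) ^ w 1 *
    (MvPowerSeries.C c + MvPowerSeries.X none) := rfl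
  rw [h0, h1, map_mul, map_pow, map_pow, map_pow, map_mul, map_pow, map_add, hX, hC, hU]
  simp only [Polynomial.map_pow, Polynomial.map_add, Polynomial.map_X, Polynomial.map_C,
    Polynomial.coe_pow, Polynomial.coe_add, Polynomial.coe_X, Polynomial.coe_C]
  rw [map_pow (PowerSeries.C (R := ℂ⟦X⟧))]
  have key {S : Type} [CommRing S] (T K U : S) (p q i j : ℕ) :
      (T ^ p) ^ i * (T ^ q * (K + U)) ^ j = T ^ (p * i + q * j) * (U + K) ^ j := by
    rw [mul_pow]; ring
  exact key (S := ℂ⟦X⟧⟦X⟧) _ _ _ _ _ _ _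

/-- The chart sends the monomial with exponent `d` to `t ^ height w d * (u + c) ^ d 1`, so only
exponents of height `i` reach `t ^ i`. -/
theorem coeff_coeff_chart {w : Fin 2 → ℕ} (hw : ∀ i, 0 < w i) (c : ℂ) (f : FormalRing 2)
    (i j : ℕ) :
    PowerSeries.coeff i (PowerSeries.coeff j (R := ℂ⟦X⟧) (MvPowerSeries.optionEquivLeft Unit ℂ
      (MvPowerSeries.subst (chart w c) f))) =
      ∑ᶠ d : Fin 2 →₀ ℕ, if height w d = i then
        MvPowerSeries.coeff d f * ((Polynomial.X + Polynomial.C c) ^ d 1 : ℂ[X]).coeff j else 0 := by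
  have hcc (g : MvPowerSeries (Option Unit) ℂ) :
      PowerSeries.coeff i (PowerSeries.coeff j (R := ℂ⟦X⟧)
        (MvPowerSeries.optionEquivLeft Unit ℂ g)) =
      MvPowerSeries.coeff ((Finsupp.single () i).optionElim j) g :=
    MvPowerSeries.coeff_coeff_optionEquivLeft g j _
  rw [hcc, MvPowerSeries.coeff_subst (hasSubst_chart hw c)]
  refine finsum_congr fun d => ?_
  rw [← hcc, optionEquivLeft_chart_prod, PowerSeries.coeff_C_mul, Polynomial.coeff_coe,
    Polynomial.coeff_map, PowerSeries.coeff_mul_C, PowerSeries.coeff_X_pow, smul_eq_mul]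
  by_cases h : height w d = i
  · simp [h]
  · simp [h, Ne.symm h]

/-- The initial form at `x = 1`, as a polynomial in `y`. -/
noncomputable def dehomogenization {w : Fin 2 → ℕ} (hw : ∀ i, 0 < w i) (f : FormalRing 2) : ℂ[X] :=
  ∑ d ∈ (basis_finite hw f).toFinset,
    Polynomial.C (MvPowerSeries.coeff d f) * Polynomial.X ^ d 1

/-- On a level line of the height, `d 1` determines `d 0` because `w 0 > 0`; hence basis terms stay
distinct after setting `x = 1`. -/
theorem basis_ext {w : Fin 2 → ℕ} (hw : ∀ i, 0 < w i) {f : FormalRing 2} {d e : Fin 2 →₀ ℕ}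
    (hd : d ∈ basis w f) (he : e ∈ basis w f) (h : d 1 = e 1) : d = e := by
  have hh : height w d = height w e := (hd.2 e he.1).antisymm (he.2 d hd.1)
  rw [height, height, Fin.sum_univ_two, Fin.sum_univ_two, h] at hh
  ext i
  fin_cases i
  · exact Nat.eq_of_mul_eq_mul_left (hw 0) (Nat.add_right_cancel hh)
  · exact h

theorem coeff_dehomogenization {w : Fin 2 → ℕ} (hw : ∀ i, 0 < w i) {f : FormalRing 2}
    {d : Fin 2 →₀ ℕ} (hd : d ∈ basis w f) :
    (dehomogenization hw f).coeff (d 1) = MvPowerSeries.coeff d f := by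
  rw [dehomogenization, Polynomial.finsetSum_coeff, Finset.sum_eq_single d]
  · simp
  · intro e he hed
    rw [Polynomial.coeff_C_mul_X_pow, if_neg]
    exact fun h => hed (basis_ext hw ((Set.Finite.mem_toFinset _).1 he) hd h.symm)
  · exact fun h => absurd ((Set.Finite.mem_toFinset _).2 hd) h

/-- In the chart `x = t ^ p`, `y = t ^ q (c + u)` the series `f` is `t ^ M g`, where `g(0, u)` is
the dehomogenized initial form at `c + u`. -/
theorem exists_strict_transform {w : Fin 2 → ℕ} (hw : ∀ i, 0 < w i) (c : ℂ) {f : FormalRing 2}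
    {d : Fin 2 →₀ ℕ} (hd : d ∈ basis w f) :
    ∃ g : ℂ⟦X⟧⟦X⟧, MvPowerSeries.optionEquivLeft Unit ℂ (MvPowerSeries.subst (chart w c) f) =
        PowerSeries.C (PowerSeries.X ^ height w d) * g ∧
      ∀ j, PowerSeries.constantCoeff (PowerSeries.coeff j g) =
        (Polynomial.taylor c (dehomogenization hw f)).coeff j := by
  have hdvd (j : ℕ) : (PowerSeries.X : ℂ⟦X⟧) ^ height w d ∣ PowerSeries.coeff j (R := ℂ⟦X⟧)
      (MvPowerSeries.optionEquivLeft Unit ℂ (MvPowerSeries.subst (chart w c) f)) := by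
    rw [PowerSeries.X_pow_dvd_iff]
    intro i hi
    rw [coeff_coeff_chart hw, finsum_eq_zero_of_forall_eq_zero]
    intro e
    split_ifs with he
    · have : e ∉ supp f := fun hes => absurd (hd.2 e hes) (by omega)
      rw [show MvPowerSeries.coeff e f = 0 from not_not.1 this, zero_mul]
    · rfl
  choose q hq using hdvd
  refine ⟨PowerSeries.mk q, ?_, fun j => ?_⟩
  · refine PowerSeries.ext fun j => ?_
    rw [PowerSeries.coeff_C_mul, PowerSeries.coeff_mk]
    exact hq j
  · have h := PowerSeries.coeff_X_pow_mul (q j) (height w d) 0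
    rw [← hq j, zero_add, coeff_coeff_chart hw, PowerSeries.coeff_zero_eq_constantCoeff] at h
    rw [PowerSeries.coeff_mk, ← h, finsum_eq_sum_of_support_subset (s := (basis_finite hw f).toFinset)]
    · rw [dehomogenization, map_sum, Polynomial.finsetSum_coeff]
      refine Finset.sum_congr rfl fun e he => ?_
      rw [Set.Finite.mem_toFinset] at he
      rw [if_pos ((he.2 d hd.1).antisymm (hd.2 e he.1)), Polynomial.taylor_mul,
        Polynomial.taylor_C, Polynomial.coeff_C_mul, Polynomial.taylor_pow, Polynomial.taylor_X]
    · intro e he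
      rw [Function.mem_support, ite_ne_right_iff] at he
      rw [Set.Finite.coe_toFinset]
      exact ⟨fun h0 => he.2 (by rw [h0, zero_mul]), fun e' he' => he.1 ▸ hd.2 e' he'⟩

/-- The factor `N` comes from the ramification `t = s ^ N` of the Puiseux root and does not change
the ray. -/
theorem exists_arc {w : Fin 2 → ℕ} (hw : ∀ i, 0 < w i) {f : FormalRing 2} (hf : f ≠ 0)
    (h : ¬ IsMonomial (initialForm w hw f)) :
    ∃ N : ℕ, N ≠ 0 ∧ (fun i => N * w i) ∈ arcWeights (zeroGerm f) := by
  obtain ⟨d, hd⟩ := basis_nonempty w hf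
  obtain ⟨e, he, hed⟩ : ∃ e ∈ basis w f, e ≠ d := by
    by_contra! hall
    exact h ((isMonomial_initialForm_iff hw).2 ⟨d, Set.eq_singleton_iff_unique_mem.2 ⟨hd, hall⟩⟩)
  set G := dehomogenization hw f
  have hGd : G.coeff (d 1) ≠ 0 := by rw [coeff_dehomogenization hw hd]; exact hd.1
  have hGe : G.coeff (e 1) ≠ 0 := by rw [coeff_dehomogenization hw he]; exact he.1
  obtain ⟨c, hc, hroot⟩ := exists_root_ne_zero (fun h => hed (basis_ext hw he hd h)) hGe hGd
  have hT0 : Polynomial.taylor c G ≠ 0 := by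
    rw [Ne, Polynomial.taylor_eq_zero]
    rintro h0
    simp [h0] at hGd
  obtain ⟨g, hg, hgc⟩ := exists_strict_transform hw c hd
  -- The Weierstrass degree of `g` is the multiplicity of `c` as a root of `G`, positive because `c`
  -- is a root.
  obtain ⟨N, hN, v, hv, hzero⟩ := exists_evalArc_eq_zero g (Polynomial.taylor c G).natTrailingDegree
    (by
      rw [Nat.pos_iff_ne_zero, Ne, Polynomial.natTrailingDegree_eq_zero, not_or, not_not,
        Polynomial.taylor_coeff_zero]
      exact ⟨hT0, hroot⟩)
    (fun i hi => by rw [hgc]; exact Polynomial.coeff_eq_zero_of_lt_natTrailingDegree hi)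
    (by rw [hgc]; exact fun h => hT0 (Polynomial.trailingCoeff_eq_zero.1 h))
  have hsub := evalArc_apply hN hv (MvPowerSeries.subst (chart w c) f)
  rw [hg, map_mul, hzero, mul_zero,
    MvPowerSeries.subst_comp_subst_apply (hasSubst_chart hw c) (hasSubst_arc hN hv)] at hsub
  set b : Option Unit → ℂ⟦X⟧ := fun o => o.elim v fun _ => PowerSeries.X ^ N
  have hbs : MvPowerSeries.HasSubst b := hasSubst_arc hN hv
  have hx0 : MvPowerSeries.subst b (chart w c 0) = (PowerSeries.X ^ (N * w 0) : ℂ⟦X⟧) := by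
    change MvPowerSeries.subst b (MvPowerSeries.X (some ()) ^ w 0) = _
    rw [MvPowerSeries.subst_pow hbs, MvPowerSeries.subst_X hbs, pow_mul]
    rfl
  have hx1 : MvPowerSeries.subst b (chart w c 1) =
      (PowerSeries.X ^ (N * w 1) * (PowerSeries.C c + v) : ℂ⟦X⟧) := by
    change MvPowerSeries.subst b (MvPowerSeries.X (some ()) ^ w 1 *
      (MvPowerSeries.C c + MvPowerSeries.X none)) = _
    rw [MvPowerSeries.subst_mul hbs, MvPowerSeries.subst_pow hbs, MvPowerSeries.subst_add hbs,
      MvPowerSeries.subst_X hbs, MvPowerSeries.subst_X hbs, MvPowerSeries.subst_C, pow_mul]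
    rfl
  -- Here `c ≠ 0` matters: `c + v` is a unit, so `y` has order exactly `N * w 1`.
  have hcv : (PowerSeries.C c + v).order = 0 := by
    apply PowerSeries.order_zero_of_unit
    rw [PowerSeries.isUnit_iff_constantCoeff, map_add, hv, add_zero, PowerSeries.constantCoeff_C]
    exact hc.isUnit
  have hord (i : Fin 2) : PowerSeries.order (MvPowerSeries.subst b (chart w c i)) =
      ((N * w i : ℕ) : ℕ∞) := by
    fin_cases i
    · exact (congrArg PowerSeries.order hx0).trans (PowerSeries.order_X_pow _)
    · refine (congrArg PowerSeries.order hx1).trans ?_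
      rw [PowerSeries.order_mul, hcv, add_zero, PowerSeries.order_X_pow]
      rfl
  let γ : FormalArc 2 :=
    { coord := fun i => MvPowerSeries.subst b (chart w c i)
      constantCoeff_coord := fun i => by
        rw [← PowerSeries.order_ne_zero_iff_constCoeff_eq_zero, hord i, Nat.cast_ne_zero]
        exact mul_ne_zero hN (hw i).ne' }
  refine ⟨N, hN, γ, ?_, ?_, hord⟩
  · intro f' hf'
    obtain ⟨a, rfl⟩ := Ideal.mem_span_singleton'.1 hf'
    rw [FormalArc.pullback, MvPowerSeries.subst_mul γ.hasSubst]
    rw [show MvPowerSeries.subst γ.coord f = 0 from hsub.symm, mul_zero]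
  · intro i hi
    have := hord i
    rw [show MvPowerSeries.subst b (chart w c i) = (0 : ℂ⟦X⟧) from hi, PowerSeries.order_zero] at this
    exact ENat.top_ne_natCast _ this

end LocalTrop

theorem corollary3p10 (w : Fin 2 → ℕ) (hw : ∀ i, 0 < w i)
    (f : MvPowerSeries (Fin 2) ℂ) (hf : f ≠ 0) :
    (fun i => (w i : ℝ)) ∈ LocalTrop.localTropicalization (LocalTrop.zeroGerm f) ↔
      ¬ LocalTrop.IsMonomial (LocalTrop.initialForm w hw f) := by
  refine ⟨LocalTrop.not_isMonomial_of_mem hw, fun h => ?_⟩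
  obtain ⟨N, hN, hmem⟩ := LocalTrop.exists_arc hw hf h
  refine subset_closure (Set.mem_biUnion hmem ⟨(N : ℝ)⁻¹, by positivity, ?_⟩)
  ext i
  have : (N : ℝ) ≠ 0 := Nat.cast_ne_zero.2 hN
  simp [this]
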